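/- Let $d\ge 0$, $N\ge 1$, let $\rho$ be a probability measure on $\mathbb R^d\times\mathbb R^d$ with marginals $\rho_0$ (the reference) and $\rho_1$, and let $z^{(n)}=(z_0^{(n)},z_1^{(n)})$, $n=1,\dots,N$, be i.i.d. random pairs with law $\rho$. Let $\sigma_0>0$ and suppose that, for $\rho$-almost every pair $(z_0,z_1)$ and for every $\sigma=\sigma_{\min}\in(0,\sigma_0)$, we are given a conditional path of densities $p_t(\cdot|z_0,z_1)$, $t\in[0,1]$, a conditional vector field $u_t(\cdot|z_0,z_1)$ on $\mathbb R^d$ and a map $\phi_t(\cdot|z_0,z_1)$ (all depending on $\sigma$) such that * $p_0(\cdot|z_0,z_1)$ is a probability density, $\phi$ is the flow of $u$ on $[0,1]\times\mathbb R^d$ ($\phi_0=\mathrm{id}$, $\frac{d}{dt}\phi_t=u_t(\phi_t)$), and $p_t(\cdot|z_0,z_1)=\phi_t(\cdot|z_0,z_1)_\#\,p_0(\cdot|z_0,z_1)$ for all $t\in[0,1]$; * $p_t(x|z_0,z_1)>0$ for all $(t,x)\in[0,1]\times\mathbb R^d$, and $p$ and $u$ are jointly continuous on $[0,1]\times\mathbb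 R^d$ and locally Lipschitz in $x$, uniformly in $t\in[0,1]$; * $p_1(\cdot|z_0,z_1)=\mathcal N(z_1,\sigma^2 I)$. The Monte Carlo (MC) marginal vector field is $$u_t^{\mathrm{MC}}(x)=\sum_{n=1}^N w_n(x)\,u_t(x|z_0^{(n)},z_1^{(n)}),\qquad w_n(x)=\frac{p_t(x|z_0^{(n)},z_1^{(n)})}{\sum_{m=1}^N p_t(x|z_0^{(m)},z_1^{(m)})}.$$ Then, almost surely, the following holds. Let $\psi^\sigma$ be a flow of $u^{\mathrm{MC}}$ on $[0,1]\times\mathbb R^d$, for each $\sigma\in(0,\sigma_0)$. 1. If $p_0(\cdot|z_0,z_1)=\rho_0$ for $\rho$-almost every $(z_0,z_1)$ and every $\sigma\in(0,\sigma_0)$, that is, if $p_t(\cdot|z_0,z_1)=\phi_t(\cdot|z_0,z_1)_\#\rho_0$, then $$(\psi_1^\sigma)_\#\rho_0=\frac1N\sum_{n=1}^N\mathcal N(z_1^{(n)},\sigma^2 I)\quad\text{for all }\sigma\in(0,\sigma_0),\qquad (\psi_1^\sigma)_\#\rho_0\Longrightarrow\frac1N\sum_{n=1}^N\delta_{z_1^{(n)}}\quad\text{as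 }\sigma\to0,$$ where $\Longrightarrow$ is weak convergence (of the integrals of all bounded continuous functions). 2. In general, both assertions hold with $\rho_0$ replaced by the mixture $\frac1N\sum_{n=1}^N p_0(\cdot|z_0^{(n)},z_1^{(n)})$ of the initial laws. 3. Such a flow $\psi^\sigma$ exists for each $\sigma\in(0,\sigma_0)$ for which every $u_t(\cdot|z_0^{(n)},z_1^{(n)})$, $n=1,\dots,N$, has at most linear growth: $|u_t(x|z_0^{(n)},z_1^{(n)})|\le C_n(1+|x|)$ for all $t\in[0,1]$, $x\in\mathbb R^d$, with some constant $C_n$. -/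

import Mathlib

open MeasureTheory ProbabilityTheory Filter Topology Set
open scoped ENNReal NNReal BoundedContinuousFunction

noncomputable section

namespace FlowMatching

/-- The state space `ℝ^d` with its Euclidean norm. -/
abbrev State (d : ℕ) : Type := EuclideanSpace ℝ (Fin d)

/-- `φ` is the flow on the time interval `[0, 1]` of the time-dependent vector field `u` on the
whole space: `φ_0 = id` and `d/dt φ_t(x) = u_t(φ_t(x))` for all `x` and all `t ∈ [0, 1]`
(one-sided derivatives at the end points). -/
def IsFlow {d : ℕ} (u φ : ℝ → State d → State d) : Prop :=
  (∀ x, φ 0 x = x) ∧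
    ∀ x, ∀ t ∈ Icc (0 : ℝ) 1, HasDerivWithinAt (fun s => φ s x) (u t (φ t x)) (Icc 0 1) t

/-- The classical Cauchy-Lipschitz regularity on `[0, 1] × ℝ^d`: jointly continuous, and locally
Lipschitz in space, uniformly in time. -/
def IsLocallyRegular {d : ℕ} {F : Type*} [NormedAddCommGroup F] (f : ℝ → State d → F) : Prop :=
  ContinuousOn (fun q : ℝ × State d => f q.1 q.2) (Icc 0 1 ×ˢ univ) ∧
    ∀ R : ℝ, ∃ K : ℝ≥0, ∀ t ∈ Icc (0 : ℝ) 1, LipschitzOnWith K (f t) (Metric.closedBall 0 R)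

/-- The measure on `ℝ^d` with the Lebesgue density `q`. -/
def densityMeasure {d : ℕ} (q : State d → ℝ) : Measure (State d) :=
  volume.withDensity (fun x => ENNReal.ofReal (q x))

/-- `p` is the (density of the) probability path, `u` the vector field and `φ` the flow belonging
to one pair of end points: `p_0` is a probability density, `φ` is the flow of `u`,
`p_t = (φ_t)_# p_0` for all `t ∈ [0, 1]`, the densities are positive, and `p` and `u` are regular
enough for the Cauchy-Lipschitz theory. -/
structure IsConditionalPath {d : ℕ} (p : ℝ → State d → ℝ) (u φ : ℝ → State d → State d) :
    Prop where
  density_pos : ∀ t ∈ Icc (0 : ℝ) 1, ∀ x, 0 < p t x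
  density_regular : IsLocallyRegular p
  field_regular : IsLocallyRegular u
  initial_prob : IsProbabilityMeasure (densityMeasure (p 0))
  flow : IsFlow u φ
  push : ∀ t ∈ Icc (0 : ℝ) 1, (densityMeasure (p 0)).map (φ t) = densityMeasure (p t)

/-- The weights `w_n(x) = p_t^{(n)}(x) / ∑_m p_t^{(m)}(x)`. -/
def mcWeight {d N : ℕ} (p : Fin N → ℝ → State d → ℝ) (n : Fin N) (t : ℝ) (x : State d) : ℝ :=
  p n t x / ∑ m, p m t x

/-- The Monte Carlo marginal vector field `∑_n w_n(x) u_t^{(n)}(x)`. -/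
def mcField {d N : ℕ} (p : Fin N → ℝ → State d → ℝ) (u : Fin N → ℝ → State d → State d)
    (t : ℝ) (x : State d) : State d :=
  ∑ n, mcWeight p n t x • u n t x

/-- The mixture `(1/N) ∑_n μ_n`. -/
def average {d N : ℕ} (μ : Fin N → Measure (State d)) : Measure (State d) :=
  (N : ℝ≥0∞)⁻¹ • ∑ n, μ n

/-- The isotropic Gaussian measure `N(m, σ² I)`. -/
def isoGaussian {d : ℕ} (m : State d) (σ : ℝ) : Measure (State d) :=
  multivariateGaussian m (σ ^ 2 • (1 : Matrix (Fin d) (Fin d) ℝ))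

/-- Weak convergence of measures: convergence of the integrals of bounded continuous functions. -/
def WeaklyConverges {d : ℕ} {ι : Type*} (μ : ι → Measure (State d)) (l : Filter ι)
    (ν : Measure (State d)) : Prop :=
  ∀ f : State d →ᵇ ℝ, Tendsto (fun i => ∫ x, f x ∂(μ i)) l (𝓝 (∫ x, f x ∂ν))

end FlowMatching

end

namespace FlowMatching

/-! The proof is by duality. Write `v = mcField p u`. Its weights are chosen so that `(∑ p_n) v = ∑
p_n u_n`; hence the mixture of the conditional paths solves the continuity equation of `v`, and what
is needed is uniqueness for that equation.

Transport a compactly supported Lipschitz `h` along the flow of `v`: the resulting `G` is Lipschitz,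
vanishes outside a cylinder and satisfies `∂_t G + v · ∇G = 0` at each interior point of
differentiability. Rademacher and Fubini provide enough such points. Differentiating along each
conditional flow gives `d/dt ∑ ∫ G dp_n = ∫ (∑ p_n) (∂_t G + v · ∇G) = 0` for a.e. `t`, so the sum
is constant in time (`sum_integral_transported_eq`).

Since `ψ_1` is not known to be onto, taking `h` to be a cutoff times `f ∘ ψ_1` with `f ≥ 0` gives
only an inequality (`sum_integral_comp_flow_le`). Applied to `f + B` and `B - f`, it becomes
equality because the total masses agree (`map_average_flow`). The limit `σ → 0` then concerns
explicit Gaussians only. -/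

variable {d N : ℕ}

/-! ### Stability and uniqueness of trajectories -/

/-- `α` solves `α' = w_t(α)` on `[0, 1]`. -/
def IsTrajectory (w : ℝ → State d → State d) (α : ℝ → State d) : Prop :=
  ∀ t ∈ Icc (0 : ℝ) 1, HasDerivWithinAt α (w t (α t)) (Icc 0 1) t

theorem IsTrajectory.continuousOn {w : ℝ → State d → State d} {α : ℝ → State d}
    (h : IsTrajectory w α) : ContinuousOn α (Icc 0 1) :=
  fun t ht => (h t ht).continuousWithinAt

theorem IsTrajectory.congr_field {w v : ℝ → State d → State d} {α : ℝ → State d}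
    (h : IsTrajectory w α) (hwv : ∀ t ∈ Icc (0 : ℝ) 1, w t (α t) = v t (α t)) :
    IsTrajectory v α := fun t ht => hwv t ht ▸ h t ht

theorem IsTrajectory.dist_le_forward {w : ℝ → State d → State d} {α β : ℝ → State d} {K : ℝ≥0}
    {s : Set (State d)} (hw : ∀ t ∈ Icc (0 : ℝ) 1, LipschitzOnWith K (w t) s)
    (hα : IsTrajectory w α) (hαs : ∀ t ∈ Icc (0 : ℝ) 1, α t ∈ s)
    (hβ : IsTrajectory w β) (hβs : ∀ t ∈ Icc (0 : ℝ) 1, β t ∈ s)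
    {a t : ℝ} (ha : 0 ≤ a) (hat : a ≤ t) (ht : t ≤ 1) :
    dist (α t) (β t) ≤ dist (α a) (β a) * Real.exp (K * (t - a)) := by
  have hsub : Icc a 1 ⊆ Icc 0 1 := Icc_subset_Icc_left ha
  have key : ∀ γ : ℝ → State d, IsTrajectory w γ → ∀ r ∈ Ico a 1,
      HasDerivWithinAt γ (w r (γ r)) (Ici r) r := fun γ hγ r hr =>
    (hγ r (hsub (Ico_subset_Icc_self hr))).mono_of_mem_nhdsWithin
      (mem_of_superset (Icc_mem_nhdsGE hr.2) (Icc_subset_Icc_left (ha.trans hr.1)))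
  exact dist_le_of_trajectories_ODE_of_mem (v := w) (s := fun _ => s)
    (fun r hr => hw r (hsub (Ico_subset_Icc_self hr)))
    (hα.continuousOn.mono hsub) (key α hα) (fun r hr => hαs r (hsub (Ico_subset_Icc_self hr)))
    (hβ.continuousOn.mono hsub) (key β hβ) (fun r hr => hβs r (hsub (Ico_subset_Icc_self hr)))
    le_rfl t ⟨hat, ht⟩

/-- Time reversal turns the forward Grönwall estimate into a backward one. -/
theorem IsTrajectory.reverse {w : ℝ → State d → State d} {α : ℝ → State d}
    (hα : IsTrajectory w α) :
    IsTrajectory (fun t x => -w (1 - t) x) (fun t => α (1 - t)) := by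
  intro t ht
  have ht' : 1 - t ∈ Icc (0 : ℝ) 1 := ⟨by linarith [ht.2], by linarith [ht.1]⟩
  have h1 : HasDerivWithinAt (fun r : ℝ => 1 - r) (-1) (Icc 0 1) t :=
    (hasDerivWithinAt_id t _).const_sub 1
  have := (hα (1 - t) ht').scomp t h1
    (fun r hr => ⟨by linarith [hr.2], by linarith [hr.1]⟩)
  simpa [Function.comp_def] using this

/-- Two trajectories of a Lipschitz field: the distance at one time controls the distance at
every other time, earlier or later. -/
theorem IsTrajectory.dist_le {w : ℝ → State d → State d} {α β : ℝ → State d} {K : ℝ≥0}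
    {s : Set (State d)} (hw : ∀ t ∈ Icc (0 : ℝ) 1, LipschitzOnWith K (w t) s)
    (hα : IsTrajectory w α) (hαs : ∀ t ∈ Icc (0 : ℝ) 1, α t ∈ s)
    (hβ : IsTrajectory w β) (hβs : ∀ t ∈ Icc (0 : ℝ) 1, β t ∈ s)
    {a t : ℝ} (ha : a ∈ Icc (0 : ℝ) 1) (ht : t ∈ Icc (0 : ℝ) 1) :
    dist (α t) (β t) ≤ dist (α a) (β a) * Real.exp K := by
  have hmono : ∀ r : ℝ, r ≤ 1 →
      dist (α a) (β a) * Real.exp (K * r) ≤ dist (α a) (β a) * Real.exp K := by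
    intro r hr
    gcongr
    nlinarith [K.coe_nonneg]
  rcases le_total a t with hat | hat
  · exact (hα.dist_le_forward hw hαs hβ hβs ha.1 hat ht.2).trans
      (hmono _ (by linarith [ha.1, ht.2]))
  · have hI : ∀ r ∈ Icc (0 : ℝ) 1, 1 - r ∈ Icc (0 : ℝ) 1 :=
      fun r hr => ⟨by linarith [hr.2], by linarith [hr.1]⟩
    have := hα.reverse.dist_le_forward (K := K) (s := s) (fun r hr => (hw _ (hI r hr)).neg)
      (fun r hr => hαs _ (hI r hr)) hβ.reverse (fun r hr => hβs _ (hI r hr))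
      (a := 1 - a) (t := 1 - t) (hI a ha).1 (by linarith) (hI t ht).2
    simp only [sub_sub_cancel] at this
    exact this.trans (hmono _ (by linarith [ha.2, ht.1]))

theorem IsTrajectory.eq_of_eq {w : ℝ → State d → State d} {α β : ℝ → State d} {K : ℝ≥0}
    {s : Set (State d)} (hw : ∀ t ∈ Icc (0 : ℝ) 1, LipschitzOnWith K (w t) s)
    (hα : IsTrajectory w α) (hαs : ∀ t ∈ Icc (0 : ℝ) 1, α t ∈ s)
    (hβ : IsTrajectory w β) (hβs : ∀ t ∈ Icc (0 : ℝ) 1, β t ∈ s)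
    {a t : ℝ} (ha : a ∈ Icc (0 : ℝ) 1) (ht : t ∈ Icc (0 : ℝ) 1) (h : α a = β a) :
    α t = β t := by
  have := hα.dist_le hw hαs hβ hβs ha ht
  rw [h, dist_self, zero_mul] at this
  exact dist_le_zero.1 this

/-! ### Globally Lipschitz bounded fields -/

/-- A field on `[0, 1] × ℝ^d` that is bounded, continuous in time and Lipschitz in space. -/
structure IsGloballyRegular (w : ℝ → State d → State d) (K M : ℝ≥0) : Prop where
  lipschitz : ∀ t ∈ Icc (0 : ℝ) 1, LipschitzWith K (w t)
  continuousOn : ∀ x, ContinuousOn (fun t => w t x) (Icc 0 1)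
  norm_le : ∀ t ∈ Icc (0 : ℝ) 1, ∀ x, ‖w t x‖ ≤ M

theorem IsGloballyRegular.exists_trajectory {w : ℝ → State d → State d} {K M : ℝ≥0}
    (hw : IsGloballyRegular w K M) {a : ℝ} (ha : a ∈ Icc (0 : ℝ) 1) (x : State d) :
    ∃ α, α a = x ∧ IsTrajectory w α := by
  -- At speed at most `M`, a curve cannot leave the ball of radius `M` within time `1`, so a single
  -- Picard-Lindelöf interval suffices.
  have hpl : IsPicardLindelof w (⟨a, ha⟩ : Icc (0 : ℝ) 1) x M 0 M K :=
    { lipschitzOnWith := fun t ht => (hw.lipschitz t ht).lipschitzOnWith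
      continuousOn := fun y _ => hw.continuousOn y
      norm_le := fun t ht y _ => hw.norm_le t ht y
      mul_max_le := by
        have : max (1 - a) (a - 0) ≤ 1 := max_le (by linarith [ha.1]) (by linarith [ha.2])
        simpa using mul_le_of_le_one_right M.coe_nonneg this }
  exact hpl.exists_eq_forall_mem_Icc_hasDerivWithinAt₀

theorem IsGloballyRegular.dist_time_le {w : ℝ → State d → State d} {K M : ℝ≥0}
    (hw : IsGloballyRegular w K M) {α : ℝ → State d} (hα : IsTrajectory w α) {s t : ℝ}
    (hs : s ∈ Icc (0 : ℝ) 1) (ht : t ∈ Icc (0 : ℝ) 1) : dist (α s) (α t) ≤ M * dist s t := by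
  simpa [dist_eq_norm] using (convex_Icc (0 : ℝ) 1).norm_image_sub_le_of_norm_hasDerivWithin_le
    hα (fun r hr => hw.norm_le r hr _) ht hs

theorem IsGloballyRegular.dist_le {w : ℝ → State d → State d} {K M : ℝ≥0}
    (hw : IsGloballyRegular w K M) {α β : ℝ → State d} (hα : IsTrajectory w α)
    (hβ : IsTrajectory w β) {a t : ℝ} (ha : a ∈ Icc (0 : ℝ) 1) (ht : t ∈ Icc (0 : ℝ) 1) :
    dist (α t) (β t) ≤ dist (α a) (β a) * Real.exp K :=
  hα.dist_le (s := univ) (fun r hr => (hw.lipschitz r hr).lipschitzOnWith)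
    (fun _ _ => mem_univ _) hβ (fun _ _ => mem_univ _) ha ht

theorem IsGloballyRegular.eq_of_eq {w : ℝ → State d → State d} {K M : ℝ≥0}
    (hw : IsGloballyRegular w K M) {α β : ℝ → State d} (hα : IsTrajectory w α)
    (hβ : IsTrajectory w β) {a t : ℝ} (ha : a ∈ Icc (0 : ℝ) 1) (ht : t ∈ Icc (0 : ℝ) 1)
    (h : α a = β a) : α t = β t :=
  hα.eq_of_eq (s := univ) (fun r hr => (hw.lipschitz r hr).lipschitzOnWith)
    (fun _ _ => mem_univ _) hβ (fun _ _ => mem_univ _) ha ht h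

/-! ### Truncation of locally regular fields -/

/-- The coordinatewise retraction of `ℝ^d` onto the cube `[-R, R]^d`. -/
noncomputable def clamp (R : ℝ) (x : State d) : State d :=
  WithLp.toLp 2 fun i => max (-R) (min R (x i))

theorem lipschitzWith_clamp (R : ℝ) : LipschitzWith 1 (clamp (d := d) R) := by
  refine LipschitzWith.mk_one fun x y => ?_
  rw [EuclideanSpace.dist_eq, EuclideanSpace.dist_eq]
  refine Real.sqrt_le_sqrt (Finset.sum_le_sum fun i _ => ?_)
  have : dist (clamp R x i) (clamp R y i) ≤ dist (x i) (y i) := by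
    simp only [clamp, Real.dist_eq]
    grind
  gcongr

theorem clamp_eq_self {R : ℝ} {x : State d} (hx : ‖x‖ ≤ R) : clamp R x = x := by
  ext i
  have h : |x i| ≤ R := (PiLp.norm_apply_le x i).trans hx
  obtain ⟨h1, h2⟩ := abs_le.1 h
  simp [clamp, h1, h2]

theorem norm_clamp_le {R : ℝ} (hR : 0 ≤ R) (x : State d) : ‖clamp R x‖ ≤ ‖x‖ := by
  have h0 : clamp R (0 : State d) = 0 := clamp_eq_self (by simpa using hR)
  simpa [h0] using (lipschitzWith_clamp R).dist_le_mul x 0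

theorem norm_clamp_le_radius {R : ℝ} (hR : 0 ≤ R) (x : State d) :
    ‖clamp R x‖ ≤ √(d * R ^ 2) := by
  rw [EuclideanSpace.norm_eq]
  refine Real.sqrt_le_sqrt ?_
  have : ∀ i ∈ Finset.univ, ‖clamp R x i‖ ^ 2 ≤ R ^ 2 := by
    intro i _
    have : ‖clamp R x i‖ ≤ R := by
      simp only [clamp, Real.norm_eq_abs]
      grind
    gcongr
  simpa using Finset.sum_le_card_nsmul _ _ _ this

theorem IsLocallyRegular.exists_bound {F : Type*} [NormedAddCommGroup F] {f : ℝ → State d → F}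
    (hf : IsLocallyRegular f) (R : ℝ) :
    ∃ M : ℝ≥0, ∀ t ∈ Icc (0 : ℝ) 1, ∀ x, ‖x‖ ≤ R → ‖f t x‖ ≤ M := by
  obtain ⟨M, hM⟩ := (isCompact_Icc.prod
    (isCompact_closedBall (0 : State d) R)).exists_bound_of_continuousOn
    (hf.1.mono (prod_mono_right (subset_univ _)))
  exact ⟨M.toNNReal, fun t ht x hx => (hM (t, x) ⟨ht, by simpa using hx⟩).trans
    (Real.le_coe_toNNReal M)⟩

theorem IsLocallyRegular.continuous {F : Type*} [NormedAddCommGroup F] {f : ℝ → State d → F}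
    (hf : IsLocallyRegular f) {t : ℝ} (ht : t ∈ Icc (0 : ℝ) 1) : Continuous (f t) :=
  hf.1.comp_continuous (by fun_prop : Continuous fun x : State d => (t, x)) fun _ => ⟨ht, mem_univ _⟩

/-- The truncated field only sees `v` on a compact cube, yet agrees with `v` on the ball of radius
`R`: trajectories staying in that ball solve both equations. -/
theorem IsLocallyRegular.isGloballyRegular_clamp {v : ℝ → State d → State d}
    (hv : IsLocallyRegular v) {R : ℝ} (hR : 0 ≤ R) :
    ∃ K M : ℝ≥0, IsGloballyRegular (fun t x => v t (clamp R x)) K M := by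
  obtain ⟨K, hK⟩ := hv.2 √(d * R ^ 2)
  obtain ⟨M, hM⟩ := hv.exists_bound √(d * R ^ 2)
  refine ⟨K, M, fun t ht => ?_, fun x => ?_, fun t ht x => hM t ht _ (norm_clamp_le_radius hR x)⟩
  · have := (hK t ht).comp (lipschitzWith_clamp (d := d) R).lipschitzOnWith (s := univ)
      fun x _ => by simpa using norm_clamp_le_radius hR x
    rw [mul_one, lipschitzOnWith_univ] at this
    exact this
  · exact hv.1.comp (f := fun t => (t, clamp R x)) (by fun_prop) fun t ht => ⟨ht, mem_univ _⟩

theorem IsTrajectory.exists_norm_le {w : ℝ → State d → State d} {α : ℝ → State d}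
    (hα : IsTrajectory w α) : ∃ R, 0 ≤ R ∧ ∀ t ∈ Icc (0 : ℝ) 1, ‖α t‖ ≤ R := by
  obtain ⟨R, hR⟩ := isCompact_Icc.exists_bound_of_continuousOn hα.continuousOn
  exact ⟨max R 0, le_max_right _ _, fun t ht => (hR t ht).trans (le_max_left _ _)⟩

/-- Both trajectories are bounded by compactness of `[0, 1]`, so one local Lipschitz constant serves
both. -/
theorem IsLocallyRegular.eq_of_eq {v : ℝ → State d → State d} (hv : IsLocallyRegular v)
    {α β : ℝ → State d} (hα : IsTrajectory v α) (hβ : IsTrajectory v β) {a t : ℝ}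
    (ha : a ∈ Icc (0 : ℝ) 1) (ht : t ∈ Icc (0 : ℝ) 1) (h : α a = β a) : α t = β t := by
  obtain ⟨R, -, hR⟩ := hα.exists_norm_le
  obtain ⟨S, -, hS⟩ := hβ.exists_norm_le
  obtain ⟨K, hK⟩ := hv.2 (max R S)
  exact hα.eq_of_eq hK (fun r hr => by simp [hR r hr]) hβ (fun r hr => by simp [hS r hr])
    ha ht h

/-! ### Flows of locally Lipschitz fields -/

theorem IsFlow.isTrajectory {v ψ : ℝ → State d → State d} (h : IsFlow v ψ) (x : State d) :
    IsTrajectory v (fun t => ψ t x) := h.2 x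

/-- A flow of a locally Lipschitz field is locally bounded. -/
theorem IsFlow.exists_norm_le {v ψ : ℝ → State d → State d} (hv : IsLocallyRegular v)
    (hψ : IsFlow v ψ) (r : ℝ) :
    ∃ R, 0 ≤ R ∧ ∀ x, ‖x‖ ≤ r → ∀ t ∈ Icc (0 : ℝ) 1, ‖ψ t x‖ ≤ R := by
  suffices ∃ R, 0 ≤ R ∧ ∀ x ∈ Metric.closedBall (0 : State d) r, ∀ t ∈ Icc (0 : ℝ) 1,
      ‖ψ t x‖ ≤ R by simpa using this
  refine (isCompact_closedBall (0 : State d) r).induction_on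
    (p := fun s => ∃ R, 0 ≤ R ∧ ∀ x ∈ s, ∀ t ∈ Icc (0 : ℝ) 1, ‖ψ t x‖ ≤ R)
    ⟨0, le_rfl, by simp⟩ ?_ ?_ ?_
  · rintro s s' hss' ⟨R, hR0, hR⟩
    exact ⟨R, hR0, fun x hx => hR x (hss' hx)⟩
  · rintro s s' ⟨R, hR0, hR⟩ ⟨R', -, hR'⟩
    refine ⟨max R R', hR0.trans (le_max_left _ _), ?_⟩
    rintro x (hx | hx) t ht
    · exact (hR x hx t ht).trans (le_max_left _ _)
    · exact (hR' x hx t ht).trans (le_max_right _ _)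
  -- Compactness reduces the bound to a neighbourhood of `x₀`. Near `x₀`, truncated trajectories
  -- stay close to that of `x₀`, hence never feel the truncation.
  intro x₀ _
  obtain ⟨R, hR0, hR⟩ := (hψ.isTrajectory x₀).exists_norm_le
  obtain ⟨K, M, hw⟩ := hv.isGloballyRegular_clamp (R := R + 1) (by linarith)
  have h₀ : IsTrajectory (fun t x => v t (clamp (R + 1) x)) (fun t => ψ t x₀) :=
    (hψ.isTrajectory x₀).congr_field fun t ht => by
      rw [clamp_eq_self ((hR t ht).trans (by linarith))]
  -- Distances grow by a factor of at most `exp K`, so this radius keeps trajectories within `1` of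
  -- that of `x₀`.
  refine ⟨Metric.ball x₀ (Real.exp K)⁻¹, mem_nhdsWithin_of_mem_nhds
    (Metric.ball_mem_nhds _ (by positivity)), R + 1, by linarith, fun x hx t ht => ?_⟩
  obtain ⟨α, hα0, hα⟩ := hw.exists_trajectory (left_mem_Icc.2 zero_le_one) x
  have hbound : ∀ t ∈ Icc (0 : ℝ) 1, ‖α t‖ ≤ R + 1 := by
    intro t ht
    have h1 := hw.dist_le hα h₀ (left_mem_Icc.2 zero_le_one) ht
    simp only [hα0, hψ.1] at h1
    have h2 : dist x x₀ * Real.exp K ≤ 1 := by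
      rw [← le_div_iff₀ (Real.exp_pos _), one_div]
      exact (Metric.mem_ball.1 hx).le
    have h3 := norm_le_norm_add_norm_sub (ψ t x₀) (α t)
    rw [← dist_eq_norm] at h3
    rw [dist_comm] at h3
    linarith [hR t ht]
  have hα' : IsTrajectory v α := hα.congr_field fun t ht => by rw [clamp_eq_self (hbound t ht)]
  have : ψ t x = α t := hv.eq_of_eq (hψ.isTrajectory x) hα' (left_mem_Icc.2 zero_le_one) ht
    (by rw [hα0, hψ.1])
  exact this ▸ hbound t ht

theorem IsFlow.exists_lipschitzOnWith {v ψ : ℝ → State d → State d} (hv : IsLocallyRegular v)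
    (hψ : IsFlow v ψ) (r : ℝ) :
    ∃ K : ℝ≥0, ∀ t ∈ Icc (0 : ℝ) 1, LipschitzOnWith K (ψ t) (Metric.closedBall 0 r) := by
  obtain ⟨R, -, hR⟩ := hψ.exists_norm_le hv r
  obtain ⟨K, hK⟩ := hv.2 R
  refine ⟨(Real.exp K).toNNReal, fun t ht => LipschitzOnWith.of_dist_le_mul fun x hx y hy => ?_⟩
  have := (hψ.isTrajectory x).dist_le hK (fun r hr => by simpa using hR x (by simpa using hx) r hr)
    (hψ.isTrajectory y) (fun r hr => by simpa using hR y (by simpa using hy) r hr)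
    (left_mem_Icc.2 zero_le_one) ht
  simp only [hψ.1] at this
  rwa [Real.coe_toNNReal _ (Real.exp_pos _).le, mul_comm]

theorem IsFlow.continuous {v ψ : ℝ → State d → State d} (hv : IsLocallyRegular v)
    (hψ : IsFlow v ψ) {t : ℝ} (ht : t ∈ Icc (0 : ℝ) 1) : Continuous (ψ t) := by
  refine continuous_iff_continuousAt.2 fun x => ?_
  obtain ⟨K, hK⟩ := hψ.exists_lipschitzOnWith hv (‖x‖ + 1)
  exact (hK t ht).continuousOn.continuousAt
    (mem_of_superset (Metric.closedBall_mem_nhds x one_pos)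
      (Metric.closedBall_subset_closedBall' (by simp [add_comm])))

/-- A locally Lipschitz field of at most linear growth has a flow on `[0, 1]`. -/
theorem exists_isFlow_of_linear_growth {v : ℝ → State d → State d} (hv : IsLocallyRegular v)
    {C : ℝ} (hC : ∀ t ∈ Icc (0 : ℝ) 1, ∀ x, ‖v t x‖ ≤ C * (1 + ‖x‖)) : ∃ ψ, IsFlow v ψ := by
  have hC0 : 0 ≤ C := by
    simpa using (norm_nonneg _).trans (hC 0 (left_mem_Icc.2 zero_le_one) 0)
  suffices ∀ x, ∃ α, α 0 = x ∧ IsTrajectory v α by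
    choose α h0 hα using this
    exact ⟨fun t x => α x t, h0, hα⟩
  intro x
  -- `clamp` does not increase norms, so the truncated field has the same linear growth and its
  -- trajectory obeys this Grönwall bound: it stays where the truncation is inactive.
  set R := gronwallBound ‖x‖ C C 1 with hRdef
  have hmono := gronwallBound_mono (norm_nonneg x) hC0 hC0
  have hR : 0 ≤ R := by
    have := hmono (zero_le_one (α := ℝ))
    rw [gronwallBound_x0] at this
    exact (norm_nonneg x).trans this
  obtain ⟨K, M, hw⟩ := hv.isGloballyRegular_clamp hR
  obtain ⟨α, hα0, hα⟩ := hw.exists_trajectory (left_mem_Icc.2 zero_le_one) x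
  refine ⟨α, hα0, hα.congr_field fun t ht => ?_⟩
  have hbound := norm_le_gronwallBound_of_norm_deriv_right_le (δ := ‖x‖) (K := C) (ε := C)
    hα.continuousOn
    (fun r hr => (hα r (Ico_subset_Icc_self hr)).mono_of_mem_nhdsWithin
      (mem_of_superset (Icc_mem_nhdsGE hr.2) (Icc_subset_Icc_left hr.1)))
    (by rw [hα0])
    (fun r hr => by
      refine (hC r (Ico_subset_Icc_self hr) _).trans ?_
      have := mul_le_mul_of_nonneg_left (norm_clamp_le hR (α r)) hC0
      linarith) t ht
  rw [clamp_eq_self (hbound.trans (hmono (by linarith [ht.2])))]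

/-! ### Regularity and growth of the Monte Carlo field -/

theorem IsLocallyRegular.sum {ι F : Type*} [Fintype ι] [NormedAddCommGroup F]
    {f : ι → ℝ → State d → F} (hf : ∀ i, IsLocallyRegular (f i)) :
    IsLocallyRegular (fun t x => ∑ i, f i t x) := by
  refine ⟨continuousOn_finsetSum _ fun i _ => (hf i).1, fun R => ?_⟩
  choose K hK using fun i => (hf i).2 R
  refine ⟨∑ i, K i, fun t ht => LipschitzOnWith.of_dist_le_mul fun x hx y hy => ?_⟩
  refine (dist_sum_sum_le _ _ _).trans ?_
  rw [NNReal.coe_sum, Finset.sum_mul]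
  exact Finset.sum_le_sum fun i _ => (hK i t ht).dist_le_mul x hx y hy

theorem IsLocallyRegular.smul {F : Type*} [NormedAddCommGroup F] [NormedSpace ℝ F]
    {f : ℝ → State d → ℝ} {g : ℝ → State d → F} (hf : IsLocallyRegular f)
    (hg : IsLocallyRegular g) : IsLocallyRegular (fun t x => f t x • g t x) := by
  refine ⟨hf.1.smul hg.1, fun R => ?_⟩
  obtain ⟨K, hK⟩ := hf.2 R
  obtain ⟨K', hK'⟩ := hg.2 R
  obtain ⟨M, hM⟩ := hf.exists_bound R
  obtain ⟨M', hM'⟩ := hg.exists_bound R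
  refine ⟨M * K' + K * M', fun t ht => LipschitzOnWith.of_dist_le_mul fun x hx y hy => ?_⟩
  have e : f t x • g t x - f t y • g t y
      = f t x • (g t x - g t y) + (f t x - f t y) • g t y := by
    rw [smul_sub, sub_smul]; abel
  rw [dist_eq_norm, e]
  refine (norm_add_le _ _).trans ?_
  rw [norm_smul, norm_smul, ← dist_eq_norm, ← dist_eq_norm]
  have h1 := (hK t ht).dist_le_mul x hx y hy
  have h2 := (hK' t ht).dist_le_mul x hx y hy
  have h3 := hM t ht x (by simpa using hx)
  have h4 := hM' t ht y (by simpa using hy)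
  calc ‖f t x‖ * dist (g t x) (g t y) + dist (f t x) (f t y) * ‖g t y‖
      ≤ M * (K' * dist x y) + (K * dist x y) * M' := by gcongr
    _ = _ := by push_cast; ring

/-- By compactness, `1 / f` is bounded on each cylinder; no uniform lower bound on `f` is needed. -/
theorem IsLocallyRegular.inv {f : ℝ → State d → ℝ} (hf : IsLocallyRegular f)
    (hpos : ∀ t ∈ Icc (0 : ℝ) 1, ∀ x, 0 < f t x) : IsLocallyRegular (fun t x => (f t x)⁻¹) := by
  have hc : ContinuousOn (fun q : ℝ × State d => (f q.1 q.2)⁻¹) (Icc 0 1 ×ˢ univ) :=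
    hf.1.inv₀ fun q hq => (hpos q.1 hq.1 q.2).ne'
  refine ⟨hc, fun R => ?_⟩
  obtain ⟨M, hM⟩ := (isCompact_Icc.prod
    (isCompact_closedBall (0 : State d) R)).exists_bound_of_continuousOn
    (hc.mono (prod_mono_right (subset_univ _)))
  obtain ⟨K, hK⟩ := hf.2 R
  refine ⟨M.toNNReal * M.toNNReal * K,
    fun t ht => LipschitzOnWith.of_dist_le_mul fun x hx y hy => ?_⟩
  have hx' : |(f t x)⁻¹| ≤ M.toNNReal := (hM (t, x) ⟨ht, hx⟩).trans (Real.le_coe_toNNReal M)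
  have hy' : |(f t y)⁻¹| ≤ M.toNNReal := (hM (t, y) ⟨ht, hy⟩).trans (Real.le_coe_toNNReal M)
  have e : (f t x)⁻¹ - (f t y)⁻¹ = (f t x)⁻¹ * (f t y)⁻¹ * (f t y - f t x) := by
    have h1 := (hpos t ht x).ne'
    have h2 := (hpos t ht y).ne'
    field_simp
  have h := (hK t ht).dist_le_mul x hx y hy
  rw [dist_comm, Real.dist_eq] at h
  rw [Real.dist_eq, e, abs_mul, abs_mul]
  push_cast
  rw [mul_assoc (_ * _ : ℝ)]
  gcongr

variable {p : Fin N → ℝ → State d → ℝ} {u φ : Fin N → ℝ → State d → State d}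

theorem sum_density_pos (hN : 0 < N) (h : ∀ n, IsConditionalPath (p n) (u n) (φ n)) {t : ℝ}
    (ht : t ∈ Icc (0 : ℝ) 1) (x : State d) : 0 < ∑ n, p n t x := by
  have : NeZero N := ⟨hN.ne'⟩
  exact Finset.sum_pos (fun n _ => (h n).density_pos t ht x) Finset.univ_nonempty

theorem isLocallyRegular_mcField (hN : 0 < N)
    (h : ∀ n, IsConditionalPath (p n) (u n) (φ n)) : IsLocallyRegular (mcField p u) := by
  have h1 : IsLocallyRegular (fun t x => (∑ m, p m t x)⁻¹) :=
    (IsLocallyRegular.sum fun n => (h n).density_regular).inv fun t ht x => sum_density_pos hN h ht x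
  exact IsLocallyRegular.sum fun n => ((h n).density_regular.smul h1).smul (h n).field_regular

/-- The algebraic link between `mcField` and the conditional fields: the fluxes add up. -/
theorem sum_smul_mcField (hN : 0 < N) (h : ∀ n, IsConditionalPath (p n) (u n) (φ n)) {t : ℝ}
    (ht : t ∈ Icc (0 : ℝ) 1) (x : State d) :
    (∑ n, p n t x) • mcField p u t x = ∑ n, p n t x • u n t x := by
  rw [mcField, Finset.smul_sum]
  refine Finset.sum_congr rfl fun n _ => ?_
  rw [mcWeight, smul_smul, mul_div_cancel₀ _ (sum_density_pos hN h ht x).ne']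

theorem norm_mcField_le (hN : 0 < N) (h : ∀ n, IsConditionalPath (p n) (u n) (φ n))
    {C : Fin N → ℝ} (hC : ∀ n, ∀ t ∈ Icc (0 : ℝ) 1, ∀ x, ‖u n t x‖ ≤ C n * (1 + ‖x‖)) {t : ℝ}
    (ht : t ∈ Icc (0 : ℝ) 1) (x : State d) :
    ‖mcField p u t x‖ ≤ (∑ n, |C n|) * (1 + ‖x‖) := by
  rw [mcField, Finset.sum_mul]
  refine (norm_sum_le _ _).trans (Finset.sum_le_sum fun n _ => ?_)
  have hpos := sum_density_pos hN h ht x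
  have hw0 : 0 ≤ mcWeight p n t x := div_nonneg ((h n).density_pos t ht x).le hpos.le
  have hw1 : mcWeight p n t x ≤ 1 := (div_le_one hpos).2
    (Finset.single_le_sum (f := fun m => p m t x)
      (fun m _ => ((h m).density_pos t ht x).le) (Finset.mem_univ n))
  rw [norm_smul, Real.norm_eq_abs, abs_of_nonneg hw0]
  calc mcWeight p n t x * ‖u n t x‖ ≤ 1 * (|C n| * (1 + ‖x‖)) := by
        gcongr
        refine (hC n t ht x).trans ?_
        gcongr
        exact le_abs_self _
    _ = _ := one_mul _

theorem exists_isFlow_mcField (hN : 0 < N) (h : ∀ n, IsConditionalPath (p n) (u n) (φ n))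
    (hC : ∀ n, ∃ C : ℝ, ∀ t ∈ Icc (0 : ℝ) 1, ∀ x, ‖u n t x‖ ≤ C * (1 + ‖x‖)) :
    ∃ ψ, IsFlow (mcField p u) ψ := by
  choose C hC using hC
  exact exists_isFlow_of_linear_growth (isLocallyRegular_mcField hN h)
    fun t ht x => norm_mcField_le hN h hC ht x

/-! ### Transported test functions -/

/-- A Lipschitz test function on `[0, 1] × ℝ^d`, bounded and supported in a cylinder, that solves
the transport equation `∂_t G + v · ∇G = 0` wherever it is differentiable. -/
structure IsTransported (v : ℝ → State d → State d) (G : ℝ × State d → ℝ) (L : ℝ≥0) (R B : ℝ) :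
    Prop where
  lipschitz : LipschitzOnWith L G (Icc 0 1 ×ˢ univ)
  eq_zero : ∀ t ∈ Icc (0 : ℝ) 1, ∀ x, R < ‖x‖ → G (t, x) = 0
  abs_le : ∀ q, |G q| ≤ B
  fderiv_eq_zero : ∀ t ∈ Ioo (0 : ℝ) 1, ∀ x, DifferentiableAt ℝ G (t, x) →
    fderiv ℝ G (t, x) (1, v t x) = 0

/-- Transporting a Lipschitz function with bounded support along a flow. -/
theorem IsFlow.exists_isTransported {v ψ : ℝ → State d → State d} (hv : IsLocallyRegular v)
    (hψ : IsFlow v ψ) {h : State d → ℝ} {Kh : ℝ≥0} (hh : LipschitzWith Kh h) {B r : ℝ}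
    (hB : ∀ x, |h x| ≤ B) (hr : ∀ x, r < ‖x‖ → h x = 0) :
    ∃ G L R, IsTransported v G L R B ∧ (∀ x, G (0, x) = h x) ∧
      ∀ x, G (1, x) ≠ 0 → ∃ z, ψ 1 z = x ∧ G (1, x) = h z := by
  obtain ⟨R, hR0, hR⟩ := hψ.exists_norm_le hv r
  obtain ⟨K, M, hw⟩ := hv.isGloballyRegular_clamp (R := R + 1) (by linarith)
  set w : ℝ → State d → State d := fun t x => v t (clamp (R + 1) x) with hwdef
  have h0 : (0 : ℝ) ∈ Icc (0 : ℝ) 1 := left_mem_Icc.2 zero_le_one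
  -- Trajectories of `v` may blow up backward in time. Those of the truncation `w` do not, so they
  -- define `G` everywhere.
  choose A hA0 hA using fun (t : Icc (0 : ℝ) 1) (x : State d) => hw.exists_trajectory t.2 x
  set G : ℝ × State d → ℝ := fun q => h (A (projIcc 0 1 zero_le_one q.1) q.2 0) with hG
  have hGα : ∀ α, IsTrajectory w α → ∀ t ∈ Icc (0 : ℝ) 1, G (t, α t) = h (α 0) := by
    intro α hα t ht
    have : projIcc 0 1 zero_le_one t = ⟨t, ht⟩ := projIcc_of_mem _ ht
    simp only [hG, this]
    rw [hw.eq_of_eq (hA ⟨t, ht⟩ (α t)) hα ht h0 (hA0 ⟨t, ht⟩ (α t))]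
  have hGA : ∀ t (ht : t ∈ Icc (0 : ℝ) 1), ∀ x, G (t, x) = h (A ⟨t, ht⟩ x 0) := by
    intro t ht x
    simpa [hA0 ⟨t, ht⟩ x] using hGα _ (hA ⟨t, ht⟩ x) t ht
  -- If `G ≠ 0`, the backward trajectory ends in the support of `h`; by uniqueness for `w` it is a
  -- genuine trajectory of `ψ`, confined to the ball of radius `R`.
  have hne : ∀ t ∈ Icc (0 : ℝ) 1, ∀ x, G (t, x) ≠ 0 →
      ∃ z, ‖z‖ ≤ r ∧ ψ t z = x ∧ G (t, x) = h z := by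
    intro t ht x hx
    rw [hGA t ht] at hx ⊢
    set z := A ⟨t, ht⟩ x 0 with hz
    have hzr : ‖z‖ ≤ r := by
      by_contra! hlt
      exact hx (hr z hlt)
    refine ⟨z, hzr, ?_, rfl⟩
    have hψw : IsTrajectory w (fun s => ψ s z) := (hψ.isTrajectory z).congr_field fun s hs => by
      rw [hwdef]
      simp only
      rw [clamp_eq_self ((hR z hzr s hs).trans (by linarith))]
    have := hw.eq_of_eq hψw (hA ⟨t, ht⟩ x) h0 ht (by rw [hψ.1, hz])
    rw [this]
    exact hA0 ⟨t, ht⟩ x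
  have hzero : ∀ t ∈ Icc (0 : ℝ) 1, ∀ x, R < ‖x‖ → G (t, x) = 0 := by
    intro t ht x hx
    by_contra hcon
    obtain ⟨z, hzr, rfl, -⟩ := hne t ht x hcon
    exact absurd (hR z hzr t ht) hx.not_ge
  -- The factors come from `h`, from backward stability of `w`, and from a space shift (`1`) plus a
  -- time shift (`M`).
  refine ⟨G, Kh * ((Real.exp K).toNNReal * (1 + M)), R, ⟨?_, hzero, fun q => hB _, ?_⟩, ?_, ?_⟩
  · refine LipschitzOnWith.of_dist_le_mul ?_
    rintro ⟨t, x⟩ ⟨ht, -⟩ ⟨s, y⟩ ⟨hs, -⟩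
    simp only at ht hs
    rw [hGA t ht, hGA s hs]
    refine (hh.dist_le_mul _ _).trans ?_
    have h1 := hw.dist_le (hA ⟨t, ht⟩ x) (hA ⟨s, hs⟩ y) ht h0
    have h2 := hw.dist_time_le (hA ⟨s, hs⟩ y) hs ht
    have h3 : A ⟨t, ht⟩ x t = x := hA0 ⟨t, ht⟩ x
    have h4 : A ⟨s, hs⟩ y s = y := hA0 ⟨s, hs⟩ y
    rw [h3] at h1
    rw [h4] at h2
    have h5 : dist x (A ⟨s, hs⟩ y t) ≤ dist x y + M * dist s t :=
      (dist_triangle _ y _).trans (by gcongr)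
    have h6 : dist x y ≤ dist (t, x) (s, y) := by simp [Prod.dist_eq]
    have h7 : dist s t ≤ dist (t, x) (s, y) := by simp [Prod.dist_eq, dist_comm s t]
    have h8 : dist x (A ⟨s, hs⟩ y t) ≤ (1 + M) * dist (t, x) (s, y) := by
      refine h5.trans ?_
      rw [add_mul, one_mul]
      gcongr
    push_cast
    rw [Real.coe_toNNReal _ (Real.exp_pos _).le, mul_assoc (Kh : ℝ)]
    gcongr
    refine h1.trans ?_
    rw [mul_comm, mul_assoc]
    gcongr
  · intro t ht x hdiff
    have htI := Ioo_subset_Icc_self ht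
    have hnhds : Icc (0 : ℝ) 1 ∈ 𝓝 t := Icc_mem_nhds ht.1 ht.2
    -- Up to radius `R + 1` the velocities of `w` and `v` agree and `G` is constant along a curve;
    -- beyond it `G` vanishes locally.
    rcases le_or_gt ‖x‖ (R + 1) with hx | hx
    · set α := A ⟨t, htI⟩ x with hαdef
      have hαt : α t = x := hA0 ⟨t, htI⟩ x
      have hα : HasDerivAt α (v t x) t := by
        have := (hA ⟨t, htI⟩ x t htI).hasDerivAt hnhds
        rw [← hαdef, hαt, hwdef] at this
        simpa only [clamp_eq_self hx] using this
      have hc : HasDerivAt (fun s => (s, α s)) ((1 : ℝ), v t x) t := (hasDerivAt_id t).prodMk hα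
      have hd := hdiff
      rw [← hαt] at hd
      have h1 := hd.hasFDerivAt.comp_hasDerivAt t hc
      have h2 : HasDerivAt (G ∘ fun s => (s, α s)) 0 t :=
        (hasDerivAt_const t (h (α 0))).congr_of_eventuallyEq <| by
          filter_upwards [hnhds] with s hs using hGα α (hA ⟨t, htI⟩ x) s hs
      rw [hαt] at h1
      exact h1.unique h2
    · have : G =ᶠ[𝓝 (t, x)] fun _ => 0 := by
        have hopen : {y : State d | R < ‖y‖} ∈ 𝓝 x :=
          (isOpen_lt continuous_const continuous_norm).mem_nhds (by
            change R < ‖x‖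
            linarith)
        filter_upwards [prod_mem_nhds hnhds hopen] with q hq using hzero q.1 hq.1 q.2 hq.2
      rw [this.fderiv_eq]
      simp
  · intro x
    rw [hGA 0 h0]
    exact congrArg h (hA0 ⟨0, h0⟩ x)
  · intro x hx
    obtain ⟨z, -, h1, h2⟩ := hne 1 (right_mem_Icc.2 zero_le_one) x hx
    exact ⟨z, h1, h2⟩

theorem IsTransported.continuous {v : ℝ → State d → State d} {G : ℝ × State d → ℝ} {L : ℝ≥0}
    {R B : ℝ} (hG : IsTransported v G L R B) {t : ℝ} (ht : t ∈ Icc (0 : ℝ) 1) :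
    Continuous fun x => G (t, x) :=
  hG.lipschitz.continuousOn.comp_continuous (by fun_prop) fun _ => ⟨ht, mem_univ _⟩

/-- Along the trajectories of any field bounded on the support, `G` is Lipschitz in time, with a
constant that does not depend on the trajectory. -/
theorem IsTransported.lipschitzOnWith_along {v u : ℝ → State d → State d} {G : ℝ × State d → ℝ}
    {L M : ℝ≥0} {R B : ℝ} (hG : IsTransported v G L R B)
    (hM : ∀ t ∈ Icc (0 : ℝ) 1, ∀ x, ‖x‖ ≤ R → ‖u t x‖ ≤ M)
    {γ : ℝ → State d} (hγ : IsTrajectory u γ) :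
    LipschitzOnWith (L * (M + 1) + 1) (fun t => G (t, γ t)) (Icc 0 1) := by
  have hcont : ContinuousOn (fun t => G (t, γ t)) (Icc 0 1) :=
    hG.lipschitz.continuousOn.comp (continuousOn_id.prodMk hγ.continuousOn)
      fun t ht => ⟨ht, mem_univ _⟩
  have key : ∀ a ∈ Icc (0 : ℝ) 1, ∀ b ∈ Icc (0 : ℝ) 1, a ≤ b →
      ‖G (b, γ b) - G (a, γ a)‖ ≤ (L * (M + 1) + 1) * (b - a) := by
    intro a ha b hb hab
    have hsub : Icc a b ⊆ Icc 0 1 := Icc_subset_Icc ha.1 hb.2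
    -- `γ` may be fast outside the support of `G`, so only local slopes are bounded. The `1` in `M +
    -- 1` absorbs the time component and gives a strict slope bound; the outer `+ 1` gives the
    -- strict inequality required of the barrier.
    refine image_norm_le_of_liminf_right_slope_norm_lt_deriv_boundary
      (f := fun t => G (t, γ t) - G (a, γ a)) (f' := fun _ => L * (M + 1))
      (B := fun t => (L * (M + 1) + 1) * (t - a)) (B' := fun _ => L * (M + 1) + 1)
      ((hcont.mono hsub).sub continuousOn_const) ?_ (by simp) (by fun_prop) ?_ ?_
      (right_mem_Icc.2 hab)
    · intro t ht ρ hρ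
      have htI := hsub (Ico_subset_Icc_self ht)
      have hIcc : Icc (0 : ℝ) 1 ∈ 𝓝[>] t :=
        mem_of_superset (Ioo_mem_nhdsGT ht.2)
          (Ioo_subset_Icc_self.trans (Icc_subset_Icc htI.1 hb.2))
      have hle : ∀ᶠ z in 𝓝[>] t, ‖G (z, γ z) - G (t, γ t)‖ ≤ L * (M + 1) * (z - t) := by
        rcases le_or_gt ‖γ t‖ R with hx | hx
        · have h1 : HasDerivWithinAt γ (u t (γ t)) (Ioi t) t :=
            (hγ t htI).mono_of_mem_nhdsWithin hIcc
          have h2 := h1.limsup_norm_slope_le (r := M + 1)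
            ((hM t htI _ hx).trans_lt (lt_add_one _))
          filter_upwards [h2, hIcc, self_mem_nhdsWithin] with z hz hzI hzt
          have hzt' : 0 < z - t := sub_pos.2 hzt
          rw [Real.norm_eq_abs, abs_of_pos hzt', inv_mul_lt_iff₀ hzt'] at hz
          refine (hG.lipschitz.dist_le_mul (z, γ z) ⟨hzI, mem_univ _⟩ (t, γ t)
            ⟨htI, mem_univ _⟩).trans ?_
          rw [mul_assoc]
          gcongr
          rw [Prod.dist_eq, max_le_iff]
          constructor
          · simp only [Real.dist_eq, abs_of_pos hzt']
            nlinarith [M.coe_nonneg]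
          · simp only [dist_eq_norm]
            linarith
        · have hcγ : Tendsto γ (𝓝[>] t) (𝓝 (γ t)) :=
            ((hγ t htI).continuousWithinAt.mono_of_mem_nhdsWithin hIcc)
          filter_upwards [hcγ.norm.eventually_const_lt hx, hIcc, self_mem_nhdsWithin]
            with z hz hzI hzt
          rw [hG.eq_zero z hzI _ hz, hG.eq_zero t htI _ hx, sub_self, norm_zero]
          have : 0 ≤ z - t := (sub_pos.2 hzt).le
          positivity
      refine (Eventually.frequently ?_)
      filter_upwards [hle, self_mem_nhdsWithin] with z hz hzt
      refine lt_of_le_of_lt ?_ hρ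
      have hzt' : 0 < z - t := sub_pos.2 hzt
      rw [slope_def_field, div_le_iff₀ hzt']
      refine le_trans ?_ hz
      refine (norm_sub_norm_le _ _).trans (le_of_eq ?_)
      congr 1
      ring
    · intro t _
      simpa using (((hasDerivAt_id t).sub_const a).const_mul (L * (M + 1) + 1 : ℝ)).hasDerivWithinAt
    · intro t _ _
      linarith
  refine LipschitzOnWith.of_dist_le_mul fun s hs t ht => ?_
  push_cast
  rw [dist_eq_norm, Real.dist_eq]
  rcases le_total s t with h | h
  · rw [norm_sub_rev, abs_sub_comm, abs_of_nonneg (sub_nonneg.2 h)]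
    exact key s hs t ht h
  · rw [abs_of_nonneg (sub_nonneg.2 h)]
    exact key t ht s hs h

/-! ### Conservation along the mixture of conditional paths -/

theorem integral_densityMeasure {q : State d → ℝ} (hq : Measurable q) (hq0 : ∀ x, 0 ≤ q x)
    (g : State d → ℝ) : ∫ x, g x ∂(densityMeasure q) = ∫ x, q x * g x := by
  rw [densityMeasure, integral_withDensity_eq_integral_toReal_smul (by fun_prop) (by simp)]
  exact integral_congr_ae (.of_forall fun x => by simp [hq0 x])

theorem integrable_densityMeasure {q : State d → ℝ} (hq : Measurable q) (hq0 : ∀ x, 0 ≤ q x)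
    {g : State d → ℝ} (hg : Integrable g (densityMeasure q)) : Integrable fun x => q x * g x := by
  rw [densityMeasure, integrable_withDensity_iff_integrable_smul' (by fun_prop) (by simp)] at hg
  exact hg.congr (.of_forall fun x => by simp [hq0 x])

variable {v : ℝ → State d → State d} {G : ℝ × State d → ℝ} {L : ℝ≥0} {R B : ℝ}

theorem IsConditionalPath.integrable_transported {p : ℝ → State d → ℝ}
    {u φ : ℝ → State d → State d} (h : IsConditionalPath p u φ) (hG : IsTransported v G L R B)
    {t : ℝ} (ht : t ∈ Icc (0 : ℝ) 1) :
    Integrable (fun y => G (t, φ t y)) (densityMeasure (p 0)) := by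
  have := h.initial_prob
  refine Integrable.of_bound
    ((hG.continuous ht).comp (h.flow.continuous h.field_regular ht)).aestronglyMeasurable B
    (.of_forall fun y => hG.abs_le _)

theorem IsConditionalPath.lipschitzOnWith_integral {p : ℝ → State d → ℝ}
    {u φ : ℝ → State d → State d} (h : IsConditionalPath p u φ) (hG : IsTransported v G L R B) :
    ∃ C : ℝ≥0, LipschitzOnWith C (fun t => ∫ y, G (t, φ t y) ∂(densityMeasure (p 0)))
      (Icc 0 1) := by
  have := h.initial_prob
  obtain ⟨M, hM⟩ := h.field_regular.exists_bound R
  refine ⟨L * (M + 1) + 1, LipschitzOnWith.of_dist_le_mul fun s hs t ht => ?_⟩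
  rw [dist_eq_norm, ← integral_sub (h.integrable_transported hG hs) (h.integrable_transported hG ht)]
  refine (norm_integral_le_of_norm_le_const (.of_forall fun y => ?_)).trans_eq (by
    rw [probReal_univ, mul_one])
  rw [← dist_eq_norm]
  exact (hG.lipschitzOnWith_along hM (h.flow.isTrajectory y)).dist_le_mul s hs t ht

/-- Working along the trajectories of `φ` avoids any time derivative of `p`; the push-forward
identity returns to the density `p t` afterwards. -/
theorem IsConditionalPath.hasDerivAt_integral {p : ℝ → State d → ℝ}
    {u φ : ℝ → State d → State d} (h : IsConditionalPath p u φ) (hG : IsTransported v G L R B)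
    {t : ℝ} (ht : t ∈ Ioo (0 : ℝ) 1) (hdiff : ∀ᵐ x : State d, DifferentiableAt ℝ G (t, x)) :
    Integrable (fun x => p t x * fderiv ℝ G (t, x) (1, u t x)) ∧
      HasDerivAt (fun s => ∫ y, G (s, φ s y) ∂(densityMeasure (p 0)))
        (∫ x, p t x * fderiv ℝ G (t, x) (1, u t x)) t := by
  have := h.initial_prob
  have htI := Ioo_subset_Icc_self ht
  have hnhds : Icc (0 : ℝ) 1 ∈ 𝓝 t := Icc_mem_nhds ht.1 ht.2
  obtain ⟨M, hM⟩ := h.field_regular.exists_bound R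
  have hφ := (h.flow.continuous h.field_regular htI).measurable
  have hp : Measurable (p t) := (h.density_regular.continuous htI).measurable
  have hp0 : ∀ x, 0 ≤ p t x := fun x => (h.density_pos t htI x).le
  have hF : Measurable fun x => fderiv ℝ G (t, x) (1, u t x) := by
    have h1 : Measurable fun x : State d => fderiv ℝ G (t, x) :=
      (measurable_fderiv ℝ G).comp (by fun_prop)
    have h2 : Measurable (u t) := (h.field_regular.continuous htI).measurable
    have h3 : Continuous fun q : (ℝ × State d →L[ℝ] ℝ) × (ℝ × State d) => q.1 q.2 := by fun_prop
    exact h3.measurable.comp (h1.prodMk (measurable_const.prodMk h2))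
  -- The law of `φ t` has a density, so it does not charge the null set where `G` fails to be
  -- differentiable.
  have hae : ∀ᵐ y ∂(densityMeasure (p 0)), DifferentiableAt ℝ G (t, φ t y) := by
    refine ae_of_ae_map (p := fun x => DifferentiableAt ℝ G (t, x)) hφ.aemeasurable ?_
    rw [h.push t htI]
    exact (withDensity_absolutelyContinuous _ _).ae_le hdiff
  obtain ⟨hint, hder⟩ := hasDerivAt_integral_of_dominated_loc_of_lip
    (μ := densityMeasure (p 0)) (F := fun s y => G (s, φ s y))
    (F' := fun y => fderiv ℝ G (t, φ t y) (1, u t (φ t y)))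
    (bound := fun _ => ((L * (M + 1) + 1 : ℝ≥0) : ℝ)) hnhds
    (by
      filter_upwards [hnhds] with s hs
      exact (h.integrable_transported hG hs).aestronglyMeasurable)
    (h.integrable_transported hG htI) (hF.comp hφ).aestronglyMeasurable
    (.of_forall fun y => by
      have := hG.lipschitzOnWith_along hM (h.flow.isTrajectory y)
      rwa [Real.nnabs_coe])
    (integrable_const _)
    (by
      filter_upwards [hae] with y hy
      exact hy.hasFDerivAt.comp_hasDerivAt t
        ((hasDerivAt_id t).prodMk ((h.flow.2 y t htI).hasDerivAt hnhds)))
  rw [← integral_map (f := fun x => fderiv ℝ G (t, x) (1, u t x)) hφ.aemeasurable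
    hF.aestronglyMeasurable, h.push t htI, integral_densityMeasure hp hp0] at hder
  have hint' := (integrable_map_measure (f := φ t) hF.aestronglyMeasurable
    hφ.aemeasurable).2 hint
  rw [h.push t htI] at hint'
  exact ⟨integrable_densityMeasure hp hp0 hint', hder⟩

/-- Rademacher on the slab, then Fubini; at interior times differentiability within the slab is full
differentiability. -/
theorem IsTransported.ae_ae_differentiableAt (hG : IsTransported v G L R B) :
    ∀ᵐ t : ℝ, t ∈ Ioo (0 : ℝ) 1 → ∀ᵐ x : State d, DifferentiableAt ℝ G (t, x) := by
  have h1 := hG.lipschitz.ae_differentiableWithinAt_of_mem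
    (μ := (volume : Measure ℝ).prod (volume : Measure (State d)))
  filter_upwards [Measure.ae_ae_of_ae_prod h1] with t ht htI
  filter_upwards [ht] with x hx
  exact (hx ⟨Ioo_subset_Icc_self htI, mem_univ _⟩).differentiableAt
    (prod_mem_nhds (Icc_mem_nhds htI.1 htI.2) univ_mem)

/-- The integral of a transported test function against the mixture of the conditional paths
does not change in time. -/
theorem sum_integral_transported_eq (hN : 0 < N)
    (h : ∀ n, IsConditionalPath (p n) (u n) (φ n)) (hG : IsTransported (mcField p u) G L R B) :
    ∑ n, ∫ x, G (1, x) ∂(densityMeasure (p n 1)) =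
      ∑ n, ∫ x, G (0, x) ∂(densityMeasure (p n 0)) := by
  set H : ℝ → ℝ := fun t => ∑ n, ∫ y, G (t, φ n t y) ∂(densityMeasure (p n 0)) with hH
  have hpush : ∀ t ∈ Icc (0 : ℝ) 1, H t = ∑ n, ∫ x, G (t, x) ∂(densityMeasure (p n t)) := by
    intro t ht
    refine Finset.sum_congr rfl fun n _ => ?_
    rw [← (h n).push t ht, integral_map
      ((h n).flow.continuous (h n).field_regular ht).aemeasurable
      (hG.continuous ht).aestronglyMeasurable]
  rw [← hpush 1 (right_mem_Icc.2 zero_le_one), ← hpush 0 (left_mem_Icc.2 zero_le_one)]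
  choose C hC using fun n => (h n).lipschitzOnWith_integral hG
  have hLip : LipschitzOnWith (∑ n, C n) H (uIcc 0 1) := by
    rw [uIcc_of_le zero_le_one]
    refine LipschitzOnWith.of_dist_le_mul fun s hs t ht => ?_
    refine (dist_sum_sum_le _ _ _).trans ?_
    rw [NNReal.coe_sum, Finset.sum_mul]
    exact Finset.sum_le_sum fun n _ => (hC n).dist_le_mul s hs t ht
  have hder : ∀ᵐ t, t ∈ uIcc (0 : ℝ) 1 → HasDerivAt H 0 t := by
    have h01 : ∀ᵐ t : ℝ, t ≠ 0 ∧ t ≠ 1 :=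
      (Measure.ae_ne volume 0).and (Measure.ae_ne volume 1)
    filter_upwards [hG.ae_ae_differentiableAt, h01] with t htd hne ht
    rw [uIcc_of_le zero_le_one] at ht
    have htO : t ∈ Ioo (0 : ℝ) 1 := ⟨lt_of_le_of_ne ht.1 hne.1.symm, lt_of_le_of_ne ht.2 hne.2⟩
    have hd := fun n => (h n).hasDerivAt_integral hG htO (htd htO)
    have hsum := HasDerivAt.fun_sum (u := Finset.univ) fun n _ => (hd n).2
    rw [← integral_finsetSum _ fun n _ => (hd n).1] at hsum
    suffices hz : ∫ x, ∑ n, p n t x * fderiv ℝ G (t, x) (1, u n t x) = 0 by rwa [hz] at hsum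
    refine integral_eq_zero_of_ae ?_
    filter_upwards [htd htO] with x hx
    have h1 : ∀ n, p n t x * fderiv ℝ G (t, x) (1, u n t x)
        = fderiv ℝ G (t, x) (p n t x • ((1 : ℝ), u n t x)) :=
      fun n => by rw [map_smul, smul_eq_mul]
    -- The individual derivatives combine into one along `(1, v)`, which annihilates `G`.
    have h2 : ∑ n, p n t x • ((1 : ℝ), u n t x)
        = (∑ n, p n t x) • ((1 : ℝ), mcField p u t x) := by
      rw [Prod.smul_mk, sum_smul_mcField hN h ht]
      ext1 <;> simp [Prod.fst_sum, Prod.snd_sum]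
    simp only [h1]
    rw [← map_sum, h2, map_smul, hG.fderiv_eq_zero t htO x hx, smul_zero, Pi.zero_apply]
  -- An a.e. vanishing derivative forces constancy only thanks to absolute continuity, here from the
  -- Lipschitz bound.
  obtain ⟨c, hc⟩ := hLip.absolutelyContinuousOnInterval.const_of_ae_hasDerivAt_zero hder
  rw [hc 1 (by simp), hc 0 (by simp)]

/-! ### Cutoffs and push-forward of the mixture -/

/-- The cutoff function that is `1` on the ball of radius `k` and `0` outside that of radius
`k + 1`. -/
noncomputable def cutoff (k : ℝ) (x : State d) : ℝ := max 0 (min 1 (k + 1 - ‖x‖))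

theorem cutoff_nonneg (k : ℝ) (x : State d) : 0 ≤ cutoff k x := le_max_left _ _

theorem cutoff_le_one (k : ℝ) (x : State d) : cutoff k x ≤ 1 :=
  max_le zero_le_one (min_le_left _ _)

theorem cutoff_eq_one {k : ℝ} {x : State d} (h : ‖x‖ ≤ k) : cutoff k x = 1 := by
  rw [cutoff, min_eq_left (by linarith), max_eq_right zero_le_one]

theorem cutoff_eq_zero {k : ℝ} {x : State d} (h : k + 1 ≤ ‖x‖) : cutoff k x = 0 :=
  max_eq_left ((min_le_right _ _).trans (by linarith))

theorem dist_cutoff_le (k : ℝ) (x y : State d) : dist (cutoff k x) (cutoff k y) ≤ dist x y := by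
  have := abs_norm_sub_norm_le x y
  rw [← dist_eq_norm] at this
  rw [Real.dist_eq, cutoff, cutoff]
  grind

/-- Cutting off a bounded locally Lipschitz function yields a Lipschitz function. -/
theorem exists_lipschitzWith_cutoff_mul {F : State d → ℝ} {B : ℝ}
    (hF : ∀ R : ℝ, ∃ K : ℝ≥0, LipschitzOnWith K F (Metric.closedBall 0 R))
    (hB : ∀ x, |F x| ≤ B) {k : ℝ} (hk : 0 ≤ k) :
    ∃ K : ℝ≥0, LipschitzWith K fun x => cutoff k x * F x := by
  obtain ⟨K, hK⟩ := hF √(d * (k + 1) ^ 2)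
  have hB0 : 0 ≤ B := (abs_nonneg _).trans (hB 0)
  have hF' : ∀ x y, dist (F (clamp (k + 1) x)) (F (clamp (k + 1) y)) ≤ K * dist x y := by
    intro x y
    refine (hK.dist_le_mul _ (by simpa using norm_clamp_le_radius (by linarith) x) _
      (by simpa using norm_clamp_le_radius (by linarith) y)).trans ?_
    gcongr
    simpa using (lipschitzWith_clamp (d := d) (k + 1)).dist_le_mul x y
  -- Clamping changes `F` only where the cutoff vanishes, so `F` may be replaced by a globally
  -- Lipschitz function.
  have heq : ∀ x, cutoff k x * F x = cutoff k x * F (clamp (k + 1) x) := by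
    intro x
    rcases le_total ‖x‖ (k + 1) with h | h
    · rw [clamp_eq_self h]
    · rw [cutoff_eq_zero h, zero_mul, zero_mul]
  refine ⟨K + B.toNNReal, LipschitzWith.of_dist_le_mul fun x y => ?_⟩
  rw [heq, heq, Real.dist_eq]
  have e : ∀ a b a' b' : ℝ, a * b - a' * b' = a * (b - b') + (a - a') * b' := fun a b a' b' => by ring
  rw [e]
  refine (abs_add_le _ _).trans ?_
  rw [abs_mul, abs_mul, ← Real.dist_eq, ← Real.dist_eq, abs_of_nonneg (cutoff_nonneg k x)]
  push_cast
  rw [Real.coe_toNNReal _ hB0]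
  calc _ ≤ 1 * (K * dist x y) + dist x y * B := by
        gcongr
        · exact cutoff_le_one k x
        · exact hF' x y
        · exact dist_cutoff_le k x y
        · exact hB _
    _ = _ := by ring

variable {ψ : ℝ → State d → State d}

theorem IsConditionalPath.isProbabilityMeasure {p : ℝ → State d → ℝ}
    {u φ : ℝ → State d → State d} (h : IsConditionalPath p u φ) {t : ℝ}
    (ht : t ∈ Icc (0 : ℝ) 1) : IsProbabilityMeasure (densityMeasure (p t)) := by
  have := h.initial_prob
  rw [← h.push t ht]
  exact Measure.isProbabilityMeasure_map (h.flow.continuous h.field_regular ht).aemeasurable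

/-- The transported cutoff of `f ∘ ψ_1` satisfies `G (1, ·) ≤ f`: where `G` is nonzero the point is
`ψ_1 z` and the value is `f` times a cutoff; elsewhere `f ≥ 0` is enough. Letting the cutoff radius
grow gives the claim. -/
theorem sum_integral_comp_flow_le (hN : 0 < N) (h : ∀ n, IsConditionalPath (p n) (u n) (φ n))
    (hψ : IsFlow (mcField p u) ψ) {f : State d → ℝ} {K : ℝ≥0} (hf : LipschitzWith K f) {B : ℝ}
    (hf0 : ∀ x, 0 ≤ f x) (hfB : ∀ x, f x ≤ B) :
    ∑ n, ∫ x, f (ψ 1 x) ∂(densityMeasure (p n 0)) ≤ ∑ n, ∫ x, f x ∂(densityMeasure (p n 1)) := by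
  have h1 : (1 : ℝ) ∈ Icc (0 : ℝ) 1 := right_mem_Icc.2 zero_le_one
  have hv := isLocallyRegular_mcField hN h
  have hprob0 : ∀ n, IsProbabilityMeasure (densityMeasure (p n 0)) := fun n => (h n).initial_prob
  have hprob1 : ∀ n, IsProbabilityMeasure (densityMeasure (p n 1)) :=
    fun n => (h n).isProbabilityMeasure h1
  have hfabs : ∀ x, |f x| ≤ B := fun x => by rw [abs_of_nonneg (hf0 x)]; exact hfB x
  have hψc : Continuous (ψ 1) := hψ.continuous hv h1
  have hcutc : ∀ k : ℕ, Continuous (cutoff (d := d) (k : ℝ)) := fun k => by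
    unfold cutoff; fun_prop
  have hcutB : ∀ (k : ℕ) (x : State d), |cutoff (k : ℝ) x * f (ψ 1 x)| ≤ B := fun k x => by
    rw [abs_mul, abs_of_nonneg (cutoff_nonneg _ _)]
    exact (mul_le_of_le_one_left (abs_nonneg _) (cutoff_le_one _ _)).trans (hfabs _)
  have hlim : Tendsto (fun k : ℕ => ∑ n, ∫ x, cutoff (k : ℝ) x * f (ψ 1 x)
      ∂(densityMeasure (p n 0))) atTop (𝓝 (∑ n, ∫ x, f (ψ 1 x) ∂(densityMeasure (p n 0)))) := by
    refine tendsto_finsetSum _ fun n _ => tendsto_integral_of_dominated_convergence (fun _ => B)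
      (fun k => ((hcutc k).mul (hf.continuous.comp hψc)).aestronglyMeasurable)
      (integrable_const _) (fun k => .of_forall (hcutB k)) (.of_forall fun x => ?_)
    refine tendsto_const_nhds.congr' ?_
    filter_upwards [eventually_ge_atTop ⌈‖x‖⌉₊] with k hk
    rw [cutoff_eq_one (Nat.ceil_le.1 hk), one_mul]
  refine le_of_tendsto' hlim fun k => ?_
  obtain ⟨Kh, hKh⟩ := exists_lipschitzWith_cutoff_mul (F := fun x => f (ψ 1 x)) (B := B)
    (fun R => by
      obtain ⟨K', hK'⟩ := hψ.exists_lipschitzOnWith hv R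
      exact ⟨K * K', hf.comp_lipschitzOnWith (hK' 1 h1)⟩)
    (fun x => hfabs _) (k := (k : ℝ)) (by positivity)
  obtain ⟨G, L, R, hG, hG0, hG1⟩ := hψ.exists_isTransported hv hKh (B := B) (r := k + 1)
    (hcutB k) (fun x hx => by rw [cutoff_eq_zero hx.le, zero_mul])
  have key := sum_integral_transported_eq hN h hG
  simp only [hG0] at key
  rw [← key]
  refine Finset.sum_le_sum fun n _ => integral_mono ?_ ?_ fun x => ?_
  · exact Integrable.of_bound (hG.continuous h1).aestronglyMeasurable B
      (.of_forall fun x => hG.abs_le _)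
  · exact Integrable.of_bound hf.continuous.aestronglyMeasurable B (.of_forall hfabs)
  · by_cases hx : G (1, x) = 0
    · simpa only [hx] using hf0 x
    · obtain ⟨z, rfl, hz⟩ := hG1 x hx
      simp only [hz]
      exact mul_le_of_le_one_left (hf0 _) (cutoff_le_one _ _)

theorem isProbabilityMeasure_average (hN : 0 < N) {μ : Fin N → Measure (State d)}
    (hμ : ∀ n, IsProbabilityMeasure (μ n)) : IsProbabilityMeasure (average μ) := by
  refine ⟨?_⟩
  have : (N : ℝ≥0∞) ≠ 0 := by exact_mod_cast hN.ne'
  simp [average, ENNReal.inv_mul_cancel this (ENNReal.natCast_ne_top N)]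

theorem integral_average {μ : Fin N → Measure (State d)} {f : State d → ℝ}
    (hf : ∀ n, Integrable f (μ n)) :
    ∫ x, f x ∂(average μ) = (N : ℝ)⁻¹ * ∑ n, ∫ x, f x ∂(μ n) := by
  rw [average, integral_smul_measure, integral_finsetSum_measure fun n _ => hf n]
  simp

/-- Flows of the Monte Carlo marginal field push the mixture of the initial laws forward to the
mixture of the terminal laws. -/
theorem map_average_flow (hN : 0 < N) (h : ∀ n, IsConditionalPath (p n) (u n) (φ n))
    (hψ : IsFlow (mcField p u) ψ) :
    (average fun n => densityMeasure (p n 0)).map (ψ 1) = average fun n => densityMeasure (p n 1) := by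
  have h1 : (1 : ℝ) ∈ Icc (0 : ℝ) 1 := right_mem_Icc.2 zero_le_one
  have hψc : Continuous (ψ 1) := hψ.continuous (isLocallyRegular_mcField hN h) h1
  have hprob0 : ∀ n, IsProbabilityMeasure (densityMeasure (p n 0)) := fun n => (h n).initial_prob
  have hprob1 : ∀ n, IsProbabilityMeasure (densityMeasure (p n 1)) :=
    fun n => (h n).isProbabilityMeasure h1
  have hP0 := isProbabilityMeasure_average hN hprob0
  have hP1 := isProbabilityMeasure_average hN hprob1
  have hPm := Measure.isProbabilityMeasure_map
    (μ := average fun n => densityMeasure (p n 0)) hψc.aemeasurable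
  let ν₀ : ProbabilityMeasure (State d) := ⟨_, hPm⟩
  let ν₁ : ProbabilityMeasure (State d) := ⟨_, hP1⟩
  suffices ν₀ = ν₁ from congrArg Subtype.val this
  -- Viewing `ν₀` as a constant sequence converging to `ν₁` reduces equality to bounded Lipschitz
  -- test functions.
  have ht : Tendsto (fun _ : ℕ => ν₀) atTop (𝓝 ν₁) := by
    rw [tendsto_iff_forall_lipschitz_integral_tendsto]
    rintro f ⟨C, hC⟩ ⟨K, hK⟩
    have hB : ∀ x, |f x| ≤ |f 0| + C := fun x => by
      have := hC x 0
      rw [Real.dist_eq] at this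
      linarith [abs_sub_abs_le_abs_sub (f x) (f 0)]
    set B := |f 0| + C
    have hi : ∀ (μ : Measure (State d)) [IsProbabilityMeasure μ] (g : State d → State d),
        Continuous g → Integrable (fun x => f (g x)) μ := fun μ _ g hg =>
      Integrable.of_bound (hK.continuous.comp hg).aestronglyMeasurable B (.of_forall fun x => hB _)
    have hi' : ∀ (μ : Measure (State d)) [IsProbabilityMeasure μ], Integrable f μ :=
      fun μ _ => hi μ id continuous_id
    -- The shifts make both functions nonnegative; they cancel because all measures involved have
    -- mass one.
    have hup := sum_integral_comp_flow_le hN h hψ (f := fun x => f x + B) (K := K + 0)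
      (hK.add (LipschitzWith.const B)) (B := B + B)
      (fun x => by linarith [(abs_le.1 (hB x)).1]) (fun x => by linarith [(abs_le.1 (hB x)).2])
    have hlo := sum_integral_comp_flow_le hN h hψ (f := fun x => B - f x) (K := 0 + K)
      ((LipschitzWith.const B).sub hK) (B := B + B)
      (fun x => by linarith [(abs_le.1 (hB x)).2]) (fun x => by linarith [(abs_le.1 (hB x)).1])
    have e1 : ∀ n, ∫ x, (f (ψ 1 x) + B) ∂(densityMeasure (p n 0))
        = (∫ x, f (ψ 1 x) ∂(densityMeasure (p n 0))) + B := fun n => by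
      rw [integral_add (hi _ _ hψc) (integrable_const _)]; simp
    have e2 : ∀ n, ∫ x, (f x + B) ∂(densityMeasure (p n 1))
        = (∫ x, f x ∂(densityMeasure (p n 1))) + B := fun n => by
      rw [integral_add (hi' _) (integrable_const _)]; simp
    have e3 : ∀ n, ∫ x, (B - f (ψ 1 x)) ∂(densityMeasure (p n 0))
        = B - ∫ x, f (ψ 1 x) ∂(densityMeasure (p n 0)) := fun n => by
      rw [integral_sub (integrable_const _) (hi _ _ hψc)]; simp
    have e4 : ∀ n, ∫ x, (B - f x) ∂(densityMeasure (p n 1))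
        = B - ∫ x, f x ∂(densityMeasure (p n 1)) := fun n => by
      rw [integral_sub (integrable_const _) (hi' _)]; simp
    simp only [e1, e2, e3, e4, Finset.sum_add_distrib, Finset.sum_sub_distrib] at hup hlo
    have heq : ∫ x, f x ∂(ν₀ : Measure (State d)) = ∫ x, f x ∂(ν₁ : Measure (State d)) := by
      change ∫ x, f x ∂((average fun n => densityMeasure (p n 0)).map (ψ 1)) =
        ∫ x, f x ∂(average fun n => densityMeasure (p n 1))
      rw [integral_map hψc.aemeasurable hK.continuous.aestronglyMeasurable,
        integral_average fun n => hi _ _ hψc, integral_average fun n => hi' _]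
      congr 1
      linarith
    simp only [heq]
    exact tendsto_const_nhds
  exact tendsto_nhds_unique tendsto_const_nhds ht

/-! ### The limit of vanishing variance -/

theorem isoGaussian_eq_map (m : State d) {σ : ℝ} (hσ : 0 ≤ σ) :
    isoGaussian m σ = (stdGaussian (State d)).map (fun x => m + σ • x) := by
  open scoped MatrixOrder in
  have hs : CFC.sqrt (σ ^ 2 • (1 : Matrix (Fin d) (Fin d) ℝ)) = σ • 1 :=
    CFC.sqrt_unique (by simp [pow_two, smul_smul]) (smul_nonneg hσ zero_le_one)
  simp [isoGaussian, multivariateGaussian, hs]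

/-- Scaling a fixed standard Gaussian puts `σ` into the integrand, where dominated convergence
applies. -/
theorem tendsto_integral_isoGaussian (m : State d) (f : State d →ᵇ ℝ) :
    Tendsto (fun σ => ∫ x, f x ∂(isoGaussian m σ)) (𝓝[>] 0) (𝓝 (f m)) := by
  have h : Tendsto (fun σ : ℝ => ∫ x, f (m + σ • x) ∂(stdGaussian (State d))) (𝓝[>] 0)
      (𝓝 (∫ _, f m ∂(stdGaussian (State d)))) := by
    refine tendsto_integral_filter_of_dominated_convergence (fun _ => ‖f‖)
      (.of_forall fun σ => (by fun_prop : Continuous fun x => f (m + σ • x)).aestronglyMeasurable)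
      (.of_forall fun σ => .of_forall fun x => f.norm_coe_le_norm _) (integrable_const _)
      (.of_forall fun x => ?_)
    have : Continuous fun σ : ℝ => f (m + σ • x) := by fun_prop
    simpa using (this.tendsto 0).mono_left nhdsWithin_le_nhds
  simp only [integral_const, probReal_univ, one_smul] at h
  refine h.congr' ?_
  filter_upwards [self_mem_nhdsWithin] with σ hσ
  rw [isoGaussian_eq_map m (le_of_lt hσ), integral_map (by fun_prop)
    f.continuous.aestronglyMeasurable]

theorem weaklyConverges_average_isoGaussian (m : Fin N → State d) :
    WeaklyConverges (fun σ => average fun n => isoGaussian (m n) σ) (𝓝[>] 0)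
      (average fun n => Measure.dirac (m n)) := by
  intro f
  have hi : ∀ (μ : Measure (State d)) [IsProbabilityMeasure μ], Integrable f μ :=
    fun μ _ => f.integrable μ
  have hg : ∀ n σ, IsProbabilityMeasure (isoGaussian (m n) σ) := fun n σ => by
    unfold isoGaussian; infer_instance
  simp only [integral_average fun n => hi (isoGaussian (m n) _),
    integral_average fun n => hi (Measure.dirac (m n)), integral_dirac]
  exact (tendsto_finsetSum _ fun n _ => tendsto_integral_isoGaussian (m n) f).const_mul _

theorem WeaklyConverges.congr {ι : Type*} {μ μ' : ι → Measure (State d)} {l : Filter ι}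
    {ν : Measure (State d)} (h : WeaklyConverges μ l ν) (heq : ∀ᶠ i in l, μ i = μ' i) :
    WeaklyConverges μ' l ν := fun f =>
  (h f).congr' (heq.mono fun i hi => by rw [hi])

theorem average_const (hN : 0 < N) (μ : Measure (State d)) : average (fun _ : Fin N => μ) = μ := by
  have : (N : ℝ≥0∞) ≠ 0 := by exact_mod_cast hN.ne'
  rw [average, Finset.sum_const, Finset.card_univ, Fintype.card_fin, ← Nat.cast_smul_eq_nsmul ℝ≥0∞,
    smul_smul, ENNReal.inv_mul_cancel this (ENNReal.natCast_ne_top N), one_smul]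

end FlowMatching

open FlowMatching in
theorem proposition4p2 {d N : ℕ} (hN : 0 < N)
    {Ω : Type*} [MeasurableSpace Ω] (P : Measure Ω) [IsProbabilityMeasure P]
    -- the reference and target measures and a coupling of them
    (ρ₀ ρ₁ : Measure (State d)) [IsProbabilityMeasure ρ₀] [IsProbabilityMeasure ρ₁]
    (ρ : Measure (State d × State d)) [IsProbabilityMeasure ρ]
    (hρ₀ : ρ.map Prod.fst = ρ₀) (hρ₁ : ρ.map Prod.snd = ρ₁)
    -- the i.i.d. sample pairs `Z n = (z₀⁽ⁿ⁾, z₁⁽ⁿ⁾)` with law `ρ`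
    (Z : Fin N → Ω → State d × State d) (hZmeas : ∀ n, Measurable (Z n))
    (hZindep : iIndepFun Z P) (hZlaw : ∀ n, P.map (Z n) = ρ)
    -- conditional densities, fields and flows, for `σ = σ_min` in `(0, σ₀)`, given `z = (z₀, z₁)`
    (σ₀ : ℝ) (hσ₀ : 0 < σ₀)
    (p : ℝ → State d × State d → ℝ → State d → ℝ)
    (u φ : ℝ → State d × State d → ℝ → State d → State d)
    (hpath : ∀ᵐ z ∂ρ, ∀ σ ∈ Ioo 0 σ₀, IsConditionalPath (p σ z) (u σ z) (φ σ z))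
    (hend : ∀ᵐ z ∂ρ, ∀ σ ∈ Ioo 0 σ₀, densityMeasure (p σ z 1) = isoGaussian z.2 σ) :
    ∀ᵐ ω ∂P,
      -- every flow of the MC marginal vector field, for each `σ`
      (∀ ψ : ℝ → ℝ → State d → State d,
        (∀ σ ∈ Ioo 0 σ₀,
          IsFlow (mcField (fun n => p σ (Z n ω)) (fun n => u σ (Z n ω))) (ψ σ)) →
        -- all conditional paths start at the reference measure `ρ₀`
        ((∀ᵐ z ∂ρ, ∀ σ ∈ Ioo 0 σ₀, densityMeasure (p σ z 0) = ρ₀) →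
          (∀ σ ∈ Ioo 0 σ₀, ρ₀.map (ψ σ 1) = average (fun n => isoGaussian (Z n ω).2 σ)) ∧
          WeaklyConverges (fun σ => ρ₀.map (ψ σ 1)) (𝓝[>] 0)
            (average (fun n => Measure.dirac (Z n ω).2))) ∧
        -- general conditional paths: start at the mixture of their initial laws
        ((∀ σ ∈ Ioo 0 σ₀,
            (average (fun n => densityMeasure (p σ (Z n ω) 0))).map (ψ σ 1) =
              average (fun n => isoGaussian (Z n ω).2 σ)) ∧
          WeaklyConverges
            (fun σ => (average (fun n => densityMeasure (p σ (Z n ω) 0))).map (ψ σ 1)) (𝓝[>] 0)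
            (average (fun n => Measure.dirac (Z n ω).2)))) ∧
      -- the flow exists if the conditional vector fields have at most linear growth
      (∀ σ ∈ Ioo 0 σ₀,
        (∀ n, ∃ C : ℝ, ∀ t ∈ Icc (0 : ℝ) 1, ∀ x, ‖u σ (Z n ω) t x‖ ≤ C * (1 + ‖x‖)) →
        ∃ ψ, IsFlow (mcField (fun n => p σ (Z n ω)) (fun n => u σ (Z n ω))) ψ) := by
  have hae : ∀ {q : State d × State d → Prop}, (∀ᵐ z ∂ρ, q z) → ∀ᵐ ω ∂P, ∀ n, q (Z n ω) := by
    intro q hq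
    refine ae_all_iff.2 fun n => ae_of_ae_map (hZmeas n).aemeasurable ?_
    rwa [hZlaw n]
  -- The premise does not depend on `ω`, so deciding it beforehand keeps the exceptional null set
  -- independent of it.
  have hstart : ∀ᵐ ω ∂P, (∀ᵐ z ∂ρ, ∀ σ ∈ Ioo 0 σ₀, densityMeasure (p σ z 0) = ρ₀) →
      ∀ n, ∀ σ ∈ Ioo 0 σ₀, densityMeasure (p σ (Z n ω) 0) = ρ₀ := by
    by_cases h : ∀ᵐ z ∂ρ, ∀ σ ∈ Ioo 0 σ₀, densityMeasure (p σ z 0) = ρ₀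
    · filter_upwards [hae h] with ω hω _ using hω
    · exact .of_forall fun ω h' => absurd h' h
  filter_upwards [hae hpath, hae hend, hstart] with ω hω hωend hωstart
  refine ⟨fun ψ hψ => ?_, fun σ hσ hC => exists_isFlow_mcField hN (fun n => hω n σ hσ) hC⟩
  have hmix : ∀ σ ∈ Ioo 0 σ₀,
      (average (fun n => densityMeasure (p σ (Z n ω) 0))).map (ψ σ 1) =
        average (fun n => isoGaussian (Z n ω).2 σ) := by
    intro σ hσ
    rw [map_average_flow hN (fun n => hω n σ hσ) (hψ σ hσ)]
    simp only [hωend _ σ hσ]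
  -- Equality for `σ` in `(0, σ₀)` is enough: this interval is a right neighbourhood of `0`.
  have hweak : ∀ μ : ℝ → Measure (State d),
      (∀ σ ∈ Ioo 0 σ₀, (μ σ).map (ψ σ 1) = average (fun n => isoGaussian (Z n ω).2 σ)) →
      WeaklyConverges (fun σ => (μ σ).map (ψ σ 1)) (𝓝[>] 0)
        (average (fun n => Measure.dirac (Z n ω).2)) := fun μ hμ =>
    (weaklyConverges_average_isoGaussian fun n => (Z n ω).2).congr <| by
      filter_upwards [Ioo_mem_nhdsGT hσ₀] with σ hσ using (hμ σ hσ).symm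
  refine ⟨fun h0 => ?_, hmix, hweak _ hmix⟩
  have href : ∀ σ ∈ Ioo 0 σ₀, ρ₀.map (ψ σ 1) = average (fun n => isoGaussian (Z n ω).2 σ) := by
    intro σ hσ
    have := hmix σ hσ
    simpa only [hωstart h0 _ σ hσ, average_const hN] using this
  exact ⟨href, hweak _ href⟩
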